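/- A \emph{cascade} $(V,\sqsubset)$ is a tree (the predecessors of each element are well ordered) with a least element $\varnothing_V$, in which every non-empty subset has a maximal element. For $v\in V$ let $V^{+}(v)$ be the set of immediate successors of $v$ and $V(v)=\{x\in V: v\sqsubseteq x\}$. The cascade is \emph{sequential} if $V^{+}(v)$ is countably infinite for every $v\in V\setminus\max V$. The rank $r_V(v)$ is $0$ if $v\in\max V$, and otherwise is the least ordinal greater than the ranks of the successors of $v$; $r(V):=r_V(\varnothing_V)$. A sequential cascade is \emph{monotone} if for each $v\in V\setminus\max V$ the set $V^{+}(v)$ admits an order of type $\omega$ for which $r_V$ is non-decreasing. If $\max V\subset X$, the \emph{contour} $\int V$ is the filter on $X$ defined inductively as follows: it is the principal filter of $\varnothing_V$ if $r(V)=0$, and otherwise $S\in\int V$ if and only if $S\in\int V(v)$ for all but finitely many $v\in V^{+}(\varnothing_V)$. A \emph{monotone sequential contour} on $X$ is a filter of the form $\int V$, where $V$ is a monotone sequential cascade with $\max V\subset X$. The rank $r(\mathcal F)$ of a sequential contour $\mathcal F$ on $X$ is the least rank $r(V)$ of a (not necessarily monotone) sequential cascade $V$ with $\max V\subset X$ and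 $\int V=\mathcal F$. Let $X$ and $Y$ be sets. (1) If $V,W$ are monotone sequential cascades with $\max V,\max W\subset X$ and $\int V=\int W$, then $r(V)=r(W)$. (2) Consequently the rank of a monotone sequential contour does not depend on the monotone cascade that represents it: if $\mathcal F$ is a filter on $X$ and $\mathcal F=\int V$ for a monotone sequential cascade $V$ with $\max V\subset X$, then $r(\mathcal F)=r(V)$. (3) If $\mathcal F$ is a monotone sequential contour on $X$, $\mathcal G$ is a monotone sequential contour on $Y$ and $r(\mathcal G)>r(\mathcal F)$, then there is no map $f:X\to Y$ with $f(\mathcal F)\geq\mathcal G$, where $f(\mathcal F)=\{B\subset Y: f^{-1}(B)\in\mathcal F\}$ and $\geq$ means "finer than or equal to" (that is, $f(\mathcal F)\supseteq\mathcal G$). -/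

import Mathlib

open Filter

universe u

/-- A cascade whose maximal elements are points of `X`: a tree (the predecessors of every element
are well ordered) with a least element, well-founded for the inverse order.  The maximal elements
are regarded as points of `X` through the injection `leaf`; the other elements are arbitrary. -/
structure Cascade (X : Type u) where
  /-- The underlying set of the cascade. -/
  carrier : Type u
  /-- The tree order. -/
  [order : PartialOrder carrier]
  /-- The least element. -/
  [root : OrderBot carrier]
  /-- The predecessors of each element are well ordered. -/
  tree : ∀ v : carrier, IsWellOrder (Set.Iio v) (· < ·)
  /-- Each nonempty subset has a maximal element. -/
  wf : WellFoundedGT carrier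
  /-- The maximal elements are (distinct) points of `X`. -/
  leaf : {v : carrier // IsMax v} ↪ X

namespace Cascade

variable {X : Type u} (V : Cascade X)

instance : PartialOrder V.carrier := V.order

instance : OrderBot V.carrier := V.root

instance : WellFoundedGT V.carrier := V.wf

/-- The set `V⁺(v)` of immediate successors of `v`. -/
def succs (v : V.carrier) : Set V.carrier := {w | v ⋖ w}

/-- The rank `r_V(v)` of an element: the least ordinal greater than the ranks of all the
successors of `v`; in particular it is `0` if `v` is maximal. -/
noncomputable def rankAt (v : V.carrier) : Ordinal.{u} :=
  IsWellFounded.rank (α := V.carrier) (· > ·) v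

/-- The rank `r(V)`, that is, the rank of the least element. -/
noncomputable def rank : Ordinal.{u} := V.rankAt ⊥

/-- A cascade is sequential if each non-maximal element has a countably infinite set of immediate
successors. -/
def IsSequential : Prop :=
  ∀ v : V.carrier, ¬ IsMax v → (V.succs v).Countable ∧ (V.succs v).Infinite

/-- Monotone sequential cascades: for each non-maximal `v` the set of immediate successors of `v`
admits an order of type `ω` (an enumeration) for which the rank is non-decreasing. -/
def IsMonotoneSequential : Prop :=
  V.IsSequential ∧
    ∀ v : V.carrier, ¬ IsMax v →
      ∃ e : ℕ ≃ V.succs v, Monotone fun n => V.rankAt (e n : V.carrier)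

open Classical in
/-- The contour `∫ V(v)`, as a filter on `X`, of the cascade `V(v) = {x | v ≤ x}`.  If `v` is
maximal it is the principal filter of the point `v`; otherwise it is the contour
(set-theoretic lower limit) of the filters `∫ V(w)`, `w ∈ V⁺(v)`, along the cofinite filter of
`V⁺(v)`.  The lower limit of filters along a filter is `Filter.bind`. -/
noncomputable def contourAt (v : V.carrier) : Filter X :=
  if h : IsMax v then pure (V.leaf ⟨v, h⟩)
  else (cofinite : Filter (V.succs v)).bind fun w => contourAt w.1
termination_by wellFounded_gt.wrap v
decreasing_by exact w.2.lt

/-- The contour `∫ V`. -/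
noncomputable def contour : Filter X := V.contourAt ⊥

end Cascade

/-- `Filter.bind` is the set-theoretic lower limit `⋃ A ∈ 𝒜, ⋂ y ∈ A, ℬ y`. -/
theorem bind_sets_eq_lowerLimit {X Y : Type*} (𝒜 : Filter Y) (ℬ : Y → Filter X) :
    (𝒜.bind ℬ).sets = ⋃ A ∈ 𝒜, ⋂ y ∈ A, (ℬ y).sets := by
  ext S
  simp only [Filter.mem_sets, Filter.mem_bind, Set.mem_iUnion, Set.mem_iInter, exists_prop]

/-- Monotone sequential contours on `X`. -/
def IsMonotoneSequentialContour {X : Type u} (F : Filter X) : Prop :=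
  ∃ V : Cascade X, V.IsMonotoneSequential ∧ V.contour = F

/-- The rank of a sequential contour `F` on `X`: the least rank of a sequential cascade (monotone
or not) whose contour is `F`. -/
noncomputable def contourRank {X : Type u} (F : Filter X) : Ordinal.{u} :=
  sInf {α | ∃ V : Cascade X, V.IsSequential ∧ V.contour = F ∧ V.rank = α}

/-! ### Iterated limits and the diagonal argument -/

open Set

/-! Everything follows from `IsIteratedLimit.not_le_contourAt`, by induction on the depth `a`. Let
the limit of filters `G n` of depth below `a` be finer than the limit of `C k = ∫ V(w_k)`, where
`w_k` enumerates the successors of `v`. By induction no `G n` is finer than `∫ V(v)`. By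
monotonicity almost all `w_k` have rank at least `a`, so by induction again no `G n`, even refined
so as to concentrate on the leaves above `w_k`, is finer than `C k`. The sets witnessing these
failures are diagonalized in `not_bind_le_bind_of_disjoint`. Images of sequential contours under
maps are iterated limits, so ranks can be compared along any `f`. -/

/-- Iterated sequential lower limits of principal ultrafilters, of depth at most `a`. -/
inductive IsIteratedLimit {Y : Type*} : Ordinal.{u} → Filter Y → Prop
  | pure (a : Ordinal.{u}) (y : Y) : IsIteratedLimit a (pure y)
  | bind (a : Ordinal.{u}) (b : ℕ → Ordinal.{u}) (G : ℕ → Filter Y) (hb : ∀ n, b n < a)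
      (hG : ∀ n, IsIteratedLimit (b n) (G n)) :
      IsIteratedLimit a ((atTop : Filter ℕ).bind G)

/-- An iterated limit has a finer iterated limit of the same depth containing a given set
that meets all its elements. -/
theorem IsIteratedLimit.exists_le_mem {Y : Type*} {a : Ordinal.{u}} {F : Filter Y}
    (hF : IsIteratedLimit a F) {s : Set Y} (hs : sᶜ ∉ F) :
    ∃ F' ≤ F, IsIteratedLimit a F' ∧ s ∈ F' := by
  induction hF with
  | pure a y =>
    refine ⟨_, le_rfl, .pure a y, ?_⟩
    simpa using hs
  | bind a b G hb hG ih =>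
    have hs' : ∃ᶠ n in atTop, sᶜ ∉ G n := fun h => hs (by
      rw [Filter.mem_bind']
      filter_upwards [h] with n hn
      simpa using hn)
    -- Passing to a subsequence refines the lower limit and keeps the depth bound `a`.
    obtain ⟨φ, hφ, hφs⟩ := extraction_of_frequently_atTop hs'
    choose G' hle hG' hmem using fun n => ih (φ n) (hφs n)
    refine ⟨_, ?_, .bind a (fun n => b (φ n)) G' (fun n => hb _) hG', ?_⟩
    · intro t ht
      rw [Filter.mem_bind'] at ht ⊢
      exact (hφ.tendsto_atTop.eventually ht).mono fun n hn => hle n hn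
    · rw [Filter.mem_bind']
      exact Eventually.of_forall hmem

/-- A diagonal argument for sequential lower limits. -/
theorem not_bind_le_bind_of_disjoint {Y : Type*} {C G : ℕ → Filter Y} {L : ℕ → Set Y}
    (hL : Pairwise fun j k => Disjoint (L j) (L k)) (hLC : ∀ k, L k ∈ C k)
    (hG : ∀ n, ¬ G n ≤ (atTop : Filter ℕ).bind C)
    (hB : ∀ᶠ k in atTop, ∀ n, (L k)ᶜ ∉ G n → ∃ B ∈ C k, B ∪ (L k)ᶜ ∉ G n) :
    ¬ (atTop : Filter ℕ).bind G ≤ (atTop : Filter ℕ).bind C := by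
  intro hle
  obtain ⟨k₀, hk₀⟩ := eventually_atTop.1 hB
  have hB' : ∀ k n, ∃ B ∈ C k, k₀ ≤ k → (L k)ᶜ ∉ G n → B ∪ (L k)ᶜ ∉ G n := by
    intro k n
    by_cases h : k₀ ≤ k ∧ (L k)ᶜ ∉ G n
    · obtain ⟨B, hBC, hBG⟩ := hk₀ k h.1 n h.2
      exact ⟨B, hBC, fun _ _ => hBG⟩
    · exact ⟨univ, univ_mem, fun h1 h2 => absurd ⟨h1, h2⟩ h⟩
  choose B hBC hBG using hB'
  choose A hAC hAG using fun n => Filter.not_le.1 (hG n)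
  -- `(L k)ᶜ` lies in `C j` for all `j ≠ k`, hence in both limits.
  have hfin : ∀ k, {n | (L k)ᶜ ∉ G n}.Finite := by
    intro k
    have h : (L k)ᶜ ∈ (atTop : Filter ℕ).bind C := by
      rw [Filter.mem_bind']
      filter_upwards [eventually_gt_atTop k] with j hj
      exact mem_of_superset (hLC j) (hL hj.ne').subset_compl_right
    have h' := hle h
    rw [Filter.mem_bind', ← Nat.cofinite_eq_atTop] at h'
    exact h'
  -- On `L k` only finitely many conditions are imposed, so `D` stays in the limit of `C`. The sets
  -- `B` defeat each `G n` meeting some `L k` with `k₀ ≤ k`; the sets `A` defeat the others.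
  let D : Set Y := {x | ∃ k, k₀ ≤ k ∧ x ∈ L k ∧ (∀ n, (L k)ᶜ ∉ G n → x ∈ B k n) ∧
    ∀ n ≤ k, A n ∈ C k → x ∈ A n}
  have hD : D ∈ (atTop : Filter ℕ).bind C := by
    rw [Filter.mem_bind']
    filter_upwards [eventually_ge_atTop k₀] with k hk
    have h1 : (⋂ n ∈ {n | (L k)ᶜ ∉ G n}, B k n) ∈ C k :=
      (biInter_mem (hfin k)).2 fun n _ => hBC k n
    have h2 : (⋂ n ∈ {n | n ≤ k ∧ A n ∈ C k}, A n) ∈ C k :=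
      (biInter_mem ((finite_Iic k).subset fun n hn => hn.1)).2 fun n hn => hn.2
    filter_upwards [hLC k, h1, h2] with x hx hx1 hx2
    simp only [mem_iInter] at hx1 hx2
    exact ⟨k, hk, hx, hx1, fun n hn hn' => hx2 n ⟨hn, hn'⟩⟩
  have hDG := hle hD
  rw [Filter.mem_bind'] at hDG
  obtain ⟨n, hn⟩ := Eventually.exists hDG
  by_cases hmesh : ∃ k, k₀ ≤ k ∧ (L k)ᶜ ∉ G n
  · obtain ⟨k, hk, hkn⟩ := hmesh
    refine hBG k n hk hkn (mem_of_superset hn ?_)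
    rintro x ⟨j, hj, hxj, hxB, -⟩
    by_cases hjk : j = k
    · subst hjk
      exact .inl (hxB n hkn)
    · exact .inr ((hL hjk).subset_compl_right hxj)
  · push Not at hmesh
    have hA := hAC n
    rw [Filter.mem_bind'] at hA
    obtain ⟨m, hm⟩ := eventually_atTop.1 hA
    -- Off these finitely many `L k`, each point of `D` lies in an `L k` with `m ≤ k` and `n ≤ k`,
    -- where `D` is cut down to `A n`.
    have hI : (⋂ k ∈ {k | k₀ ≤ k ∧ k < max m n}, (L k)ᶜ) ∈ G n :=
      (biInter_mem ((finite_Iio (max m n)).subset fun k hk => hk.2)).2 fun k hk => hmesh k hk.1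
    refine hAG n ?_
    filter_upwards [hn, hI] with x hx hxI
    obtain ⟨k, hk, hxk, -, hxA⟩ := hx
    simp only [mem_iInter] at hxI
    have hmk : max m n ≤ k := by
      by_contra h
      exact hxI k ⟨hk, not_le.1 h⟩ hxk
    exact hxA n ((le_max_right _ _).trans hmk) (hm k ((le_max_left _ _).trans hmk))

/-! ### Trees, ranks and contours of cascades -/

namespace Cascade

variable {X : Type u} {V : Cascade X}

theorem rankAt_lt_of_lt {v w : V.carrier} (h : v < w) : V.rankAt w < V.rankAt v :=
  IsWellFounded.rank_lt_of_rel (r := ((· > ·) : V.carrier → V.carrier → Prop)) h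

theorem rankAt_anti {v w : V.carrier} (h : v ≤ w) : V.rankAt w ≤ V.rankAt v := by
  rcases h.eq_or_lt with rfl | h
  · exact le_rfl
  · exact (rankAt_lt_of_lt h).le

theorem le_or_le_of_le {u v w : V.carrier} (hv : v ≤ u) (hw : w ≤ u) : v ≤ w ∨ w ≤ v := by
  rcases hv.eq_or_lt with rfl | hv
  · exact .inr hw
  rcases hw.eq_or_lt with rfl | hw
  · exact .inl hv.le
  have := V.tree u
  rcases trichotomous_of (· < ·) (⟨v, hv⟩ : Iio u) ⟨w, hw⟩ with h | h | h
  · exact .inl (le_of_lt h)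
  · exact .inl (congrArg Subtype.val h).le
  · exact .inr (le_of_lt h)

theorem eq_of_covBy_of_le {u v w w' : V.carrier} (hw : v ⋖ w) (hw' : v ⋖ w') (hu : w ≤ u)
    (hu' : w' ≤ u) : w = w' := by
  rcases le_or_le_of_le hu hu' with h | h
  · exact (hw'.eq_or_eq hw.le h).resolve_left hw.lt.ne'
  · exact ((hw.eq_or_eq hw'.le h).resolve_left hw'.lt.ne').symm

theorem exists_covBy_le {v u : V.carrier} (h : v < u) : ∃ w, v ⋖ w ∧ w ≤ u := by
  by_cases hne : ∃ x, v < x ∧ x < u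
  · obtain ⟨x, hvx, hxu⟩ := hne
    have hwf : WellFounded ((· < ·) : Iio u → Iio u → Prop) := (V.tree u).wf
    obtain ⟨m, hm, hmin⟩ := hwf.has_min {y : Iio u | v < y.1} ⟨⟨x, hxu⟩, hvx⟩
    exact ⟨m.1, ⟨hm, fun c hvc hcm => hmin ⟨c, hcm.trans m.2⟩ hvc hcm⟩, le_of_lt m.2⟩
  · push Not at hne
    exact ⟨u, ⟨h, fun c hvc hcu => hne c hvc hcu⟩, le_rfl⟩

theorem exists_succ_of_lt_rankAt {v : V.carrier} {a : Ordinal.{u}} (h : a < V.rankAt v) :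
    ∃ w ∈ V.succs v, a ≤ V.rankAt w := by
  by_contra! hlt
  refine h.not_ge ?_
  unfold rankAt
  rw [IsWellFounded.rank_eq]
  refine Ordinal.iSup_le fun ⟨x, hx⟩ => Order.succ_le_of_lt ?_
  obtain ⟨w, hvw, hwx⟩ := exists_covBy_le hx
  exact (rankAt_anti hwx).trans_lt (hlt w hvw)

theorem rankAt_of_isMax {v : V.carrier} (h : IsMax v) : V.rankAt v = 0 := by
  by_contra hne
  obtain ⟨w, hw, -⟩ := exists_succ_of_lt_rankAt (pos_iff_ne_zero.2 hne)
  exact h.not_lt hw.lt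

theorem contourAt_of_isMax {v : V.carrier} (h : IsMax v) :
    V.contourAt v = pure (V.leaf ⟨v, h⟩) := by
  rw [contourAt, dif_pos h]

theorem mem_contourAt {v : V.carrier} (h : ¬ IsMax v) {s : Set X} :
    s ∈ V.contourAt v ↔ ∀ᶠ w : V.succs v in cofinite, s ∈ V.contourAt w.1 := by
  rw [contourAt, dif_neg h, Filter.mem_bind']
  rfl

theorem contourAt_eq_bind {v : V.carrier} (h : ¬ IsMax v) (e : ℕ ≃ V.succs v) :
    V.contourAt v = (atTop : Filter ℕ).bind fun n => V.contourAt (e n).1 := by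
  ext s
  rw [mem_contourAt h, Filter.mem_bind', ← Nat.cofinite_eq_atTop]
  refine ⟨fun hs => e.injective.tendsto_cofinite.eventually hs, fun hs => ?_⟩
  simpa using e.symm.injective.tendsto_cofinite.eventually hs

/-- The set of leaves above `v`. -/
def leavesAbove (V : Cascade X) (v : V.carrier) : Set X :=
  {x | ∃ u, ∃ h : IsMax u, v ≤ u ∧ V.leaf ⟨u, h⟩ = x}

theorem leavesAbove_mem_contourAt (v : V.carrier) : V.leavesAbove v ∈ V.contourAt v := by
  induction v using WellFoundedGT.induction with
  | ind v ih =>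
    by_cases h : IsMax v
    · rw [contourAt_of_isMax h]
      exact ⟨v, h, le_rfl, rfl⟩
    · rw [mem_contourAt h]
      refine Eventually.of_forall fun w => mem_of_superset (ih w.1 w.2.lt) ?_
      rintro x ⟨u, hu, hwu, rfl⟩
      exact ⟨u, hu, w.2.le.trans hwu, rfl⟩

theorem disjoint_leavesAbove {v w w' : V.carrier} (hw : v ⋖ w) (hw' : v ⋖ w') (hne : w ≠ w') :
    Disjoint (V.leavesAbove w) (V.leavesAbove w') := by
  rw [Set.disjoint_left]
  rintro x ⟨u, hu, hwu, rfl⟩ ⟨u', hu', hwu', h⟩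
  obtain rfl : u' = u := congrArg Subtype.val (V.leaf.injective h)
  exact hne (eq_of_covBy_of_le hw hw' hwu hwu')

/-- Since `leaf` is injective, at most one successor is the leaf `y`. -/
theorem compl_singleton_mem_contourAt {v : V.carrier} (h : ¬ IsMax v) (y : X) :
    {y}ᶜ ∈ V.contourAt v := by
  induction v using WellFoundedGT.induction with
  | ind v ih =>
    rw [mem_contourAt h]
    refine Set.Subsingleton.finite ?_
    have key : ∀ w : V.succs v, {y}ᶜ ∉ V.contourAt w.1 →
        ∃ hw : IsMax w.1, V.leaf ⟨w.1, hw⟩ = y := by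
      intro w hw
      by_cases hmax : IsMax w.1
      · rw [contourAt_of_isMax hmax] at hw
        exact ⟨hmax, by simpa using hw⟩
      · exact absurd (ih w.1 w.2.lt hmax) hw
    intro w hw w' hw'
    obtain ⟨h1, h2⟩ := key w hw
    obtain ⟨h1', h2'⟩ := key w' hw'
    exact Subtype.ext (Subtype.mk.inj (V.leaf.injective (h2.trans h2'.symm)))

/-- The map `f` may identify leaves, so the image need not come with a cascade; iterated limits ask
for no disjointness. -/
theorem IsSequential.isIteratedLimit_map {Y : Type*} (hV : V.IsSequential) (f : X → Y)
    (v : V.carrier) : IsIteratedLimit (V.rankAt v) (Filter.map f (V.contourAt v)) := by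
  induction v using WellFoundedGT.induction with
  | ind v ih =>
    by_cases h : IsMax v
    · rw [contourAt_of_isMax h, Filter.map_pure]
      exact .pure _ _
    · have := (hV v h).1.to_subtype
      have := (hV v h).2.to_subtype
      obtain ⟨e⟩ := nonempty_equiv_of_countable (α := ℕ) (β := V.succs v)
      have hmap : Filter.map f (V.contourAt v) =
          (atTop : Filter ℕ).bind fun n => Filter.map f (V.contourAt (e n).1) := by
        rw [contourAt_eq_bind h e]
        rfl
      rw [hmap]
      exact .bind _ (fun n => V.rankAt (e n).1) _ (fun n => rankAt_lt_of_lt (e n).2.lt)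
        fun n => ih _ (e n).2.lt

end Cascade

/-- An iterated limit is never finer than a monotone sequential contour of greater rank. -/
theorem IsIteratedLimit.not_le_contourAt {X : Type u} {a : Ordinal.{u}} {F : Filter X}
    (hF : IsIteratedLimit a F) {V : Cascade X} (hV : V.IsMonotoneSequential) {v : V.carrier}
    (hv : a < V.rankAt v) : ¬ F ≤ V.contourAt v := by
  induction a using WellFoundedLT.induction generalizing F v with
  | ind a ih =>
  have hmax : ¬ IsMax v := fun h => by simp [Cascade.rankAt_of_isMax h] at hv
  cases hF with
  | pure _ y =>
    intro hle
    simpa using hle (Cascade.compl_singleton_mem_contourAt hmax y)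
  | bind _ b G hb hG =>
    obtain ⟨e, he⟩ := hV.2 v hmax
    rw [Cascade.contourAt_eq_bind hmax e]
    obtain ⟨w, hw, haw⟩ := Cascade.exists_succ_of_lt_rankAt hv
    refine not_bind_le_bind_of_disjoint (L := fun k => V.leavesAbove (e k).1) ?_
      (fun k => Cascade.leavesAbove_mem_contourAt _) ?_ ?_
    · exact fun j k hjk => Cascade.disjoint_leavesAbove (e j).2 (e k).2
        fun h => hjk (e.injective (Subtype.ext h))
    · intro n
      rw [← Cascade.contourAt_eq_bind hmax e]
      exact ih (b n) (hb n) (hG n) ((hb n).trans hv)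
    -- Monotonicity enters here: one successor of rank at least `a` forces all later ones to have
    -- it.
    · filter_upwards [eventually_ge_atTop (e.symm ⟨w, hw⟩)] with k hk n hn
      have hak : a ≤ V.rankAt (e k).1 := haw.trans (by simpa using he hk)
      -- The refinement keeps depth `b n`, so the induction hypothesis applies to it at `e k`.
      obtain ⟨G', hle, hG', hmem⟩ := (hG n).exists_le_mem hn
      obtain ⟨B, hBC, hBG⟩ := Filter.not_le.1 (ih (b n) (hb n) hG' ((hb n).trans_le hak))
      refine ⟨B, hBC, fun h => hBG ?_⟩
      filter_upwards [hle h, hmem] with x hx hx'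
      exact hx.resolve_right fun h => h hx'

theorem Cascade.rank_le_of_map_contour_le {X Y : Type u} {W : Cascade X} {V : Cascade Y}
    (hW : W.IsSequential) (hV : V.IsMonotoneSequential) {f : X → Y}
    (h : Filter.map f W.contour ≤ V.contour) : V.rank ≤ W.rank :=
  not_lt.1 fun hlt => (hW.isIteratedLimit_map f ⊥).not_le_contourAt hV hlt h

/-- Only the coarser contour must be monotone in the comparison, so competing cascades may be
arbitrary sequential ones. -/
theorem contourRank_contour {X : Type u} {V : Cascade X} (hV : V.IsMonotoneSequential) :
    contourRank V.contour = V.rank := by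
  refine le_antisymm (csInf_le' ⟨V, hV.1, rfl, rfl⟩) (le_csInf ⟨_, V, hV.1, rfl, rfl⟩ ?_)
  rintro _ ⟨W, hW, hWV, rfl⟩
  exact Cascade.rank_le_of_map_contour_le (f := id) hW hV (by rw [Filter.map_id, hWV])

theorem mainTheorem8 {X Y : Type u} :
    (∀ V W : Cascade X, V.IsMonotoneSequential → W.IsMonotoneSequential →
      V.contour = W.contour → V.rank = W.rank) ∧
    (∀ (F : Filter X) (V : Cascade X), V.IsMonotoneSequential → V.contour = F →
      contourRank F = V.rank) ∧
    (∀ (F : Filter X) (G : Filter Y),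
      IsMonotoneSequentialContour F → IsMonotoneSequentialContour G →
      contourRank F < contourRank G → ∀ f : X → Y, ¬ Filter.map f F ≤ G) := by
  refine ⟨fun V W hV hW h => ?_, ?_, ?_⟩
  · rw [← contourRank_contour hV, ← contourRank_contour hW, h]
  · rintro _ V hV rfl
    exact contourRank_contour hV
  · rintro _ _ ⟨W, hW, rfl⟩ ⟨V, hV, rfl⟩ hlt f hle
    rw [contourRank_contour hW, contourRank_contour hV] at hlt
    exact hlt.not_ge (Cascade.rank_le_of_map_contour_le hW.1 hV hle)
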